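/- Let $X$ be a connected locally finite cell complex (CW complex), let $P\colon\tilde X\to X$ be its universal covering and let $\pi=\pi_1(X)$ act on $\tilde X$ by deck transformations. Write $I=[0,1]$, and $Y^I$ for the space of paths in $Y$ with the compact-open topology. Let $\tilde X\times_\pi\tilde X$ be the quotient of $\tilde X\times\tilde X$ by the diagonal action of $\pi$, let $q\colon\tilde X\times_\pi\tilde X\to X\times X$ be the covering $q([x,y])=(Px,Py)$, and let $p\colon X^I\to\tilde X\times_\pi\tilde X$ be the map $p(\gamma)=[\tilde\gamma(0),\tilde\gamma(1)]$, where $\tilde\gamma$ is any lift of $\gamma$ to $\tilde X$. Consider the following numbers (each equal to $\infty$ if no such $k$ exists). * $\widetilde{\mathsf{TC}}(X)$ is the minimal $k\ge 0$ such that $X\times X$ has an open cover $U_0\cup\dots\cup U_k$ with the property that, for each $i$, the map $p$ admits a continuous section over $q^{-1}(U_i)$. * $\mathsf{TC}^*_\pi(\tilde X)$ (Dranishnikov's strongly equivariant topological complexity) is the minimal $k\ge 0$ such that $\tilde X\times\tilde X$ can be covered by $k+1$ open sets $\tilde U_0,\dots,\tilde U_k$, each of which is $\pi\times\pi$-invariant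 and admits a continuous section $\tilde U_i\to\tilde X^I$ of $\omega\mapsto(\omega(0),\omega(1))$ that is $\pi$-equivariant (for the diagonal action of $\pi$ on $\tilde X\times\tilde X$ and the induced action on $\tilde X^I$). * $\mathsf{TC}(\tilde X)$ is the minimal $k\ge 0$ such that $\tilde X\times\tilde X$ can be covered by $k+1$ open sets, over each of which $\tilde X^I\to\tilde X\times\tilde X$, $\omega\mapsto(\omega(0),\omega(1))$, admits a continuous section. Then $$\widetilde{\mathsf{TC}}(X)=\mathsf{TC}^*_\pi(\tilde X),$$ and consequently $$\widetilde{\mathsf{TC}}(X)\ \ge\ \mathsf{TC}(\tilde X).$$ -/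

import Mathlib

open Topology unitInterval

universe u v

noncomputable section

/-! ## Sectional categories -/

section SectionalCategory

variable {E B X : Type*} [TopologicalSpace E] [TopologicalSpace B] [TopologicalSpace X]

/-- The minimal integer `k ≥ 0` such that `B` is the union of `k + 1` open subsets, each of which
has the property `A`; it is `⊤` if there is no such `k`. -/
def coverNumber (A : Set B → Prop) : ℕ∞ :=
  sInf {n : ℕ∞ | ∃ k : ℕ, n = (k : ℕ∞) ∧ ∃ U : Fin (k + 1) → Set B,
    (∀ i, IsOpen (U i)) ∧ (⋃ i, U i) = Set.univ ∧ ∀ i, A (U i)}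

/-- The map `p : E → B` admits a continuous section over the subset `V` of `B`. -/
def HasSectionOver (p : E → B) (V : Set B) : Prop :=
  ∃ s : C(V, E), ∀ v : V, p (s v) = v

/-- The sectional category (or Schwarz genus) of `p`, in the reduced normalization. -/
def secat (p : E → B) : ℕ∞ :=
  coverNumber (HasSectionOver p)

/-- The invariant `secat~` of a tower `E → B → X`: the minimal `k` such that `X` has an open cover
`U₀, …, U_k` with `p` admitting a continuous section over each `q⁻¹(U_i)`. -/
def secatTilde (p : E → B) (q : B → X) : ℕ∞ :=
  coverNumber fun U : Set X => HasSectionOver p (q ⁻¹' U)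

end SectionalCategory

/-! ## Topological complexity and its strongly equivariant version -/

section TopologicalComplexity

/-- The free path fibration `Y^I → Y × Y`, `ω ↦ (ω(0), ω(1))`. The space of paths `C(I, Y)`
carries the compact-open topology. -/
def pathFibration (Y : Type*) [TopologicalSpace Y] (ω : C(I, Y)) : Y × Y :=
  (ω 0, ω 1)

/-- The (reduced) topological complexity of `Y`. -/
def TC (Y : Type*) [TopologicalSpace Y] : ℕ∞ :=
  secat (pathFibration Y)

variable (G : Type*) [Group G] {Y : Type*} [TopologicalSpace Y] [MulAction G Y]

/-- Invariance of a subset of `Y × Y` under the action `(g, h) • (x, y) = (g • x, h • y)`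
of `G × G`. -/
def IsProdInvariant (U : Set (Y × Y)) : Prop :=
  ∀ g h : G, ∀ x y : Y, (x, y) ∈ U → (g • x, h • y) ∈ U

/-- The path fibration of `Y` has over `U` a continuous section `s` that is `G`-equivariant for the
diagonal action of `G` on `Y × Y` and the pointwise action on paths. -/
def HasEquivariantPathSection (U : Set (Y × Y)) : Prop :=
  ∃ s : C(U, C(I, Y)), (∀ z : U, pathFibration Y (s z) = z) ∧
    ∀ (g : G) (z w : U), (w : Y × Y) = g • (z : Y × Y) → ∀ t : I, s w t = g • s z t

variable (Y)

/-- The strongly equivariant topological complexity `TC*_G(Y)`: the minimal `k` such that `Y × Y`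
is covered by `k + 1` open `G × G`-invariant subsets, each with a `G`-equivariant continuous
section of the path fibration. -/
def stronglyEquivariantTC : ℕ∞ :=
  coverNumber fun U : Set (Y × Y) => IsProdInvariant G U ∧ HasEquivariantPathSection G U

end TopologicalComplexity

/-! ## Universal coverings -/

section UniversalCovering

variable {X : Type u} [TopologicalSpace X] {X' : Type v} [TopologicalSpace X']

/-- `P : X' → X` is a universal covering: a surjective covering map with simply connected
total space. -/
structure IsUniversalCovering (P : X' → X) : Prop where
  isCoveringMap : IsCoveringMap P
  surjective : Function.Surjective P
  simplyConnected : SimplyConnectedSpace X'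

/-- The group of deck transformations of `P`, i.e. of homeomorphisms of the total space over the
base. For a universal covering of a locally path connected space `X` this is the standard
action of `π₁(X)` on the total space. -/
def DeckGroup (P : X' → X) : Subgroup (X' ≃ₜ X') where
  carrier := {g | ∀ x, P (g x) = P x}
  mul_mem' {a b} ha hb x := (ha (b x)).trans (hb x)
  one_mem' _ := rfl
  inv_mem' {a} ha x := by
    have h := ha (a.symm x)
    rw [a.apply_symm_apply] at h
    exact h.symm

instance DeckGroup.instMulAction (P : X' → X) : MulAction (DeckGroup P) X' where
  smul g x := (g : X' ≃ₜ X') x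
  one_smul _ := rfl
  mul_smul _ _ _ := rfl

theorem DeckGroup.smul_def {P : X' → X} (g : DeckGroup P) (x : X') :
    g • x = (g : X' ≃ₜ X') x := rfl

theorem DeckGroup.map_smul {P : X' → X} (g : DeckGroup P) (x : X') : P (g • x) = P x :=
  g.2 x

/-- The space `X' ×_π X'`, the quotient of `X' × X'` by the diagonal action
`g • (x, y) = (g • x, g • y)` of the deck group `π`, with the quotient topology. -/
abbrev DiagonalQuotient (P : X' → X) : Type v :=
  Quotient (MulAction.orbitRel (DeckGroup P) (X' × X'))

/-- The covering `q : X' ×_π X' → X × X`, `q [x, y] = (P x, P y)`. -/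
def diagonalQuotientProj (P : X' → X) : DiagonalQuotient P → X × X :=
  Quotient.lift (fun z : X' × X' => (P z.1, P z.2)) (by
    rintro _ b ⟨g, rfl⟩
    exact Prod.ext (DeckGroup.map_smul g b.1) (DeckGroup.map_smul g b.2))

variable {P : X' → X}

theorem IsUniversalCovering.exists_lift (hP : IsUniversalCovering P) (γ : C(I, X)) :
    ∃ Γ : C(I, X'), ∀ t, P (Γ t) = γ t := by
  obtain ⟨e, he⟩ := hP.surjective (γ 0)
  obtain ⟨Γ, hΓ, -⟩ := hP.isCoveringMap.exists_path_lifts γ e he.symm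
  exact ⟨Γ, fun t => congrFun hΓ t⟩

/-- The map `p : X^I → X' ×_π X'`, `p γ = [Γ(0), Γ(1)]`, where `Γ` is any lift of the path `γ`
along `P`; see `pathToDiagonalQuotient_eq` for the independence of the lift. -/
def pathToDiagonalQuotient (hP : IsUniversalCovering P) (γ : C(I, X)) : DiagonalQuotient P :=
  Quotient.mk _ (pathFibration X' (hP.exists_lift γ).choose)

/-- On a locally path connected space the deck group of a universal covering acts transitively on
the fibres. -/
theorem IsUniversalCovering.exists_deck [LocallyPathConnectedSpace X']
    (hP : IsUniversalCovering P) {x y : X'} (h : P x = P y) : ∃ g : DeckGroup P, g • x = y := by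
  have hc := hP.isCoveringMap
  have := hP.simplyConnected
  have key : ∀ a b : X', P a = P b → ∃ F : C(X', X'), F a = b ∧ ∀ z, P (F z) = P z := by
    intro a b hab
    obtain ⟨F, ⟨h1, h2⟩, -⟩ :=
      hc.existsUnique_continuousMap_lifts ⟨P, hc.continuous⟩ a b hab.symm
    exact ⟨F, h1, fun z => congrFun h2 z⟩
  have id_of : ∀ (F : C(X', X')) (a : X'), F a = a → (∀ z, P (F z) = P z) → ∀ z, F z = z := by
    intro F a h1 h2 z
    exact congrFun (hc.eq_of_comp_eq F.continuous continuous_id (funext h2) a h1) z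
  obtain ⟨F, hF1, hF2⟩ := key x y h
  obtain ⟨F', hF'1, hF'2⟩ := key y x h.symm
  refine ⟨⟨⟨⟨F, F', ?_, ?_⟩, F.continuous, F'.continuous⟩, hF2⟩, hF1⟩
  · exact id_of (F'.comp F) x (by simp [hF1, hF'1]) (fun z => by simp [hF2, hF'2])
  · exact id_of (F.comp F') y (by simp [hF1, hF'1]) (fun z => by simp [hF2, hF'2])

theorem pathToDiagonalQuotient_eq [LocallyPathConnectedSpace X'] (hP : IsUniversalCovering P)
    (γ : C(I, X)) (Γ : C(I, X')) (hΓ : ∀ t, P (Γ t) = γ t) :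
    pathToDiagonalQuotient hP γ = Quotient.mk _ (Γ 0, Γ 1) := by
  have hΔ := (hP.exists_lift γ).choose_spec
  set Δ := (hP.exists_lift γ).choose with hΔdef
  obtain ⟨g, hg⟩ := hP.exists_deck ((hΓ 0).trans (hΔ 0).symm)
  have hc := hP.isCoveringMap
  have heq : (fun t => g • Γ t) = Δ := by
    refine hc.eq_of_comp_eq ((g : X' ≃ₜ X').continuous.comp Γ.continuous) Δ.continuous ?_ 0 hg
    funext t
    exact (DeckGroup.map_smul g _).trans ((hΓ t).trans (hΔ t).symm)
  refine Quotient.sound ⟨g, ?_⟩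
  exact Prod.ext (congrFun heq 0) (congrFun heq 1)

/-- The invariant `TC~(X) = secat~(X^I → X' ×_π X' → X × X)`, computed with the universal covering
`P : X' → X`. -/
def TCTilde (hP : IsUniversalCovering P) : ℕ∞ :=
  secatTilde (pathToDiagonalQuotient hP) (diagonalQuotientProj P)

end UniversalCovering

/-- Local finiteness of a cell complex: every point of `X` has a neighbourhood that meets only
finitely many closed cells. -/
def IsLocallyFiniteComplex (X : Type*) [TopologicalSpace X] [CWComplex (Set.univ : Set X)] : Prop :=
  LocallyFinite fun c : Σ n : ℕ, RelCWComplex.cell (Set.univ : Set X) n =>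
    RelCWComplex.closedCell c.1 c.2

end

noncomputable section

open Metric Set Function

section CoverNumber

variable {B B' : Type*} [TopologicalSpace B] [TopologicalSpace B']

/-! Image and preimage under `P × P` match open subsets of `X × X` with open `π × π`-invariant
subsets of `X' × X'`, and they carry covers to covers. Sections correspond as well: a section of `p`
lifts to an equivariant path section (`hasEquivariantPathSection`), and an equivariant path section
followed by `P` descends to the diagonal quotient (`hasSectionOver_image`). Descent needs deck
transformations to be transitive on fibres, hence local path connectedness, which `X` has as a cell
complex and `X'` inherits. The inequality follows by forgetting equivariance and invariance. -/

theorem coverNumber_le_of_transfer {A : Set B → Prop} {A' : Set B' → Prop} (φ : Set B → Set B')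
    (hopen : ∀ U, IsOpen U → IsOpen (φ U))
    (hcover : ∀ k (U : Fin (k + 1) → Set B), ⋃ i, U i = univ → ⋃ i, φ (U i) = univ)
    (hA : ∀ U, IsOpen U → A U → A' (φ U)) : coverNumber A' ≤ coverNumber A := by
  refine sInf_le_sInf ?_
  rintro n ⟨k, rfl, U, hU, hcov, hAU⟩
  exact ⟨k, rfl, fun i => φ (U i), fun i => hopen _ (hU i), hcover k U hcov,
    fun i => hA _ (hU i) (hAU i)⟩

theorem coverNumber_mono {A A' : Set B → Prop} (h : ∀ U, A U → A' U) :
    coverNumber A' ≤ coverNumber A :=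
  coverNumber_le_of_transfer id (fun _ hU => hU) (fun _ _ hU => hU) fun U _ => h U

end CoverNumber

section LocalPathConnectedness

/-- The disjoint union of the closed balls of a cell complex maps onto the complex as a quotient
map. -/
theorem CWComplex.isQuotientMap_sigma_closedBall {X : Type*} [TopologicalSpace X] [T2Space X]
    [CWComplex (univ : Set X)] :
    IsQuotientMap fun z : Σ c : Σ n : ℕ, RelCWComplex.cell (univ : Set X) n,
      closedBall (0 : Fin c.1 → ℝ) 1 => RelCWComplex.map z.1.1 z.1.2 z.2.1 := by
  have hcont (c : Σ n : ℕ, RelCWComplex.cell (univ : Set X) n) :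
      Continuous fun z : closedBall (0 : Fin c.1 → ℝ) 1 => RelCWComplex.map c.1 c.2 z.1 :=
    continuousOn_iff_continuous_domRestrict.mp (RelCWComplex.continuousOn c.1 c.2)
  refine isQuotientMap_iff_isClosed.mpr ⟨fun x => ?_, fun A => ⟨fun hA => ?_, fun hA => ?_⟩⟩
  · have hx : x ∈ ⋃ (n : ℕ) (j : RelCWComplex.cell (univ : Set X) n),
        RelCWComplex.closedCell n j := by rw [CWComplex.union]; trivial
    obtain ⟨n, j, z, hz, rfl⟩ := by simpa only [mem_iUnion] using hx
    exact ⟨⟨⟨n, j⟩, ⟨z, hz⟩⟩, rfl⟩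
  · exact hA.preimage (continuous_sigma hcont)
  · refine CWComplex.closed' (C := univ) A (subset_univ A) fun n j => ?_
    have hc := isClosed_sigma_iff.mp hA ⟨n, j⟩
    have : CompactSpace (closedBall (0 : Fin n → ℝ) 1) :=
      isCompact_iff_compactSpace.mp (isCompact_closedBall _ _)
    -- The trace of `A` on a closed cell is the image of a compact subset of the ball, hence closed
    -- in the Hausdorff space `X`.
    convert! (hc.isCompact.image (hcont ⟨n, j⟩)).isClosed using 1
    ext x
    constructor
    · rintro ⟨hx, z, hz, rfl⟩
      exact ⟨⟨z, hz⟩, hx, rfl⟩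
    · rintro ⟨z, hz, rfl⟩
      exact ⟨hz, z.1, z.2, rfl⟩

/-- Balls are convex, and local path connectedness passes to disjoint unions and quotients. -/
theorem CWComplex.locallyPathConnectedSpace {X : Type*} [TopologicalSpace X] [T2Space X]
    [CWComplex (univ : Set X)] : LocallyPathConnectedSpace X := by
  have (c : Σ n : ℕ, RelCWComplex.cell (univ : Set X) n) :
      LocallyPathConnectedSpace (closedBall (0 : Fin c.1 → ℝ) 1) :=
    (convex_closedBall _ _).locallyPathConnectedSpace
  exact CWComplex.isQuotientMap_sigma_closedBall.locallyPathConnectedSpace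

theorem IsLocalHomeomorph.locallyPathConnectedSpace {E X : Type*} [TopologicalSpace E]
    [TopologicalSpace X] [LocallyPathConnectedSpace X] {f : E → X} (hf : IsLocalHomeomorph f) :
    LocallyPathConnectedSpace E := by
  choose e he _ using hf
  -- The local inverses of `f` serve as charts modelled on `X`.
  let _ : ChartedSpace X E :=
    { atlas := range e
      chartAt := e
      mem_chart_source := he
      chart_mem_atlas := fun x => mem_range_self x }
  exact ChartedSpace.locallyPathConnectedSpace X E

end LocalPathConnectedness

section UniversalCovering

variable {X : Type u} [TopologicalSpace X] {X' : Type v} [TopologicalSpace X'] {P : X' → X}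

omit [TopologicalSpace X] in
theorem DeckGroup.continuous_smul (g : DeckGroup P) : Continuous fun x : X' => g • x :=
  (g : X' ≃ₜ X').continuous

/-- A path whose class in the diagonal quotient is `[x, y]` lifts to a path from `x` to `y`. -/
theorem IsUniversalCovering.exists_lift_of_pathToDiagonalQuotient_eq (hP : IsUniversalCovering P)
    {γ : C(I, X)} {z : X' × X'} (h : pathToDiagonalQuotient hP γ = Quotient.mk _ z) :
    ∃ Γ : C(I, X'), (∀ t, P (Γ t) = γ t) ∧ pathFibration X' Γ = z := by
  have hΔ := (hP.exists_lift γ).choose_spec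
  obtain ⟨g, hg⟩ := Quotient.exact h.symm
  refine ⟨⟨_, (DeckGroup.continuous_smul g).comp (hP.exists_lift γ).choose.continuous⟩, ?_, ?_⟩
  · exact fun t => (DeckGroup.map_smul g _).trans (hΔ t)
  · exact hg

theorem continuous_diagonalQuotientProj (hP : Continuous P) :
    Continuous (diagonalQuotientProj P) :=
  Continuous.quotient_lift (by fun_prop) _

/-- A section of `p` over `q⁻¹(U)` lifts to an equivariant section of the path fibration over the
preimage of `U`. -/
theorem IsUniversalCovering.hasEquivariantPathSection (hP : IsUniversalCovering P)
    {U : Set (X × X)}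
    (hU : HasSectionOver (pathToDiagonalQuotient hP) (diagonalQuotientProj P ⁻¹' U)) :
    HasEquivariantPathSection (DeckGroup P) (Prod.map P P ⁻¹' U) := by
  obtain ⟨s, hs⟩ := hU
  have hc := hP.isCoveringMap
  let k : C((Prod.map P P ⁻¹' U : Set (X' × X')), (diagonalQuotientProj P ⁻¹' U : Set _)) :=
    ⟨fun w => ⟨Quotient.mk _ w.1, w.2⟩,
      (continuous_quotient_mk'.comp continuous_subtype_val).subtype_mk _⟩
  have hlift (w : (Prod.map P P ⁻¹' U : Set (X' × X'))) :=
    hP.exists_lift_of_pathToDiagonalQuotient_eq (z := w.1) (hs (k w))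
  choose Γ hΓ hΓw using hlift
  have hcont : Continuous fun z : I × (Prod.map P P ⁻¹' U : Set (X' × X')) => Γ z.2 z.1 := by
    -- A lift of a homotopy that is continuous along each path and at time `0` is jointly
    -- continuous; at time `0` it is the first projection.
    refine hc.isLocalHomeomorph.continuous_lift hc.isSeparatedMap
      ⟨fun z => s (k z.2) z.1, by fun_prop⟩ (funext fun z => hΓ z.2 z.1) ?_
      fun w => (Γ w).continuous
    exact (continuous_fst.comp continuous_subtype_val).congr
      fun w => (congrArg Prod.fst (hΓw w)).symm
  refine ⟨⟨Γ, ContinuousMap.continuous_of_continuous_uncurry _ (hcont.comp continuous_swap)⟩,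
    hΓw, fun g z w hzw t => ?_⟩
  have hk : k w = k z := Subtype.ext (Quotient.sound ⟨g, hzw.symm⟩)
  -- `Γ w` and `g • Γ z` lift the same path from the same point.
  refine congrFun (hc.eq_of_comp_eq (Γ w).continuous
    ((DeckGroup.continuous_smul g).comp (Γ z).continuous) (funext fun t => ?_) 0 ?_) t
  · exact (hΓ w t).trans (by rw [hk]; exact ((DeckGroup.map_smul g _).trans (hΓ z t)).symm)
  · have h1 := congrArg Prod.fst (hΓw w)
    have h2 := congrArg Prod.fst (hΓw z)
    exact h1.trans ((congrArg Prod.fst hzw).trans (congrArg (g • ·) h2.symm))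

/-- The two coordinates are moved by unrelated deck transformations, so diagonal invariance would
not suffice. -/
theorem IsUniversalCovering.preimage_image_of_isProdInvariant [LocallyPathConnectedSpace X']
    (hP : IsUniversalCovering P) {W : Set (X' × X')} (hW : IsProdInvariant (DeckGroup P) W) :
    Prod.map P P ⁻¹' (Prod.map P P '' W) = W := by
  refine (subset_preimage_image _ _).antisymm' ?_
  rintro ⟨x, y⟩ ⟨⟨a, b⟩, hab, h⟩
  obtain ⟨g, rfl⟩ := hP.exists_deck (congrArg Prod.fst h)
  obtain ⟨g', rfl⟩ := hP.exists_deck (congrArg Prod.snd h)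
  exact hW g g' a b hab

/-- An equivariant section of the path fibration over an invariant subset descends to a section
of `p`. -/
theorem IsUniversalCovering.hasSectionOver_image [LocallyPathConnectedSpace X']
    (hP : IsUniversalCovering P) {W : Set (X' × X')} (hWo : IsOpen W)
    (hW : IsProdInvariant (DeckGroup P) W) (hs : HasEquivariantPathSection (DeckGroup P) W) :
    HasSectionOver (pathToDiagonalQuotient hP)
      (diagonalQuotientProj P ⁻¹' (Prod.map P P '' W)) := by
  obtain ⟨s, hs, hequi⟩ := hs
  have hPc := hP.isCoveringMap.continuous
  have hPo := hP.isCoveringMap.isLocalHomeomorph.isOpenMap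
  set V := diagonalQuotientProj P ⁻¹' (Prod.map P P '' W) with hV
  have hVo : IsOpen V :=
    ((hPo.prodMap hPo) W hWo).preimage (continuous_diagonalQuotientProj hPc)
  let π : X' × X' → DiagonalQuotient P := Quotient.mk _
  have hπ : IsQuotientMap π := isQuotientMap_quotient_mk'
  -- Openness of `V` keeps the restricted projection a quotient map, so maps constant on its fibres
  -- descend continuously.
  have hr := hπ.restrictPreimage_isOpen hVo
  have hmem (z : π ⁻¹' V) : (z : X' × X') ∈ W := by
    rw [← hP.preimage_image_of_isProdInvariant hW]
    exact z.2
  let f : C(π ⁻¹' V, C(I, X)) :=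
    ⟨fun z => (ContinuousMap.mk P hPc).comp (s ⟨z.1, hmem z⟩),
      (ContinuousMap.continuous_postcomp _).comp (s.continuous.comp
        (continuous_subtype_val.subtype_mk _))⟩
  have hf (a b : π ⁻¹' V) (h : V.restrictPreimage π a = V.restrictPreimage π b) : f a = f b := by
    obtain ⟨g, hg⟩ := Quotient.exact (congrArg Subtype.val h)
    ext t
    exact (congrArg P (hequi g ⟨b.1, hmem b⟩ ⟨a.1, hmem a⟩ hg.symm t)).trans
      (DeckGroup.map_smul g _)
  obtain ⟨r, hr'⟩ : ∃ r : C(V, C(I, X)), ∀ z, r (V.restrictPreimage π z) = f z :=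
    ⟨IsQuotientMap.lift (f := ⟨_, hr.continuous⟩) hr f hf,
      fun z => DFunLike.congr_fun (IsQuotientMap.lift_comp (f := ⟨_, hr.continuous⟩) hr f hf) z⟩
  refine ⟨r, fun v => ?_⟩
  obtain ⟨z, rfl⟩ := hr.surjective v
  -- The path given by `s` is itself a lift of its projection, so it computes `p`.
  rw [hr', pathToDiagonalQuotient_eq hP (f z) (s ⟨z.1, hmem z⟩) fun _ => rfl]
  exact congrArg π (hs ⟨z.1, hmem z⟩)

theorem IsUniversalCovering.TCTilde_eq_stronglyEquivariantTC [LocallyPathConnectedSpace X']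
    (hP : IsUniversalCovering P) : TCTilde hP = stronglyEquivariantTC (DeckGroup P) X' := by
  have hPc := hP.isCoveringMap.continuous
  have hPo := hP.isCoveringMap.isLocalHomeomorph.isOpenMap
  unfold TCTilde secatTilde stronglyEquivariantTC
  apply le_antisymm
  · refine coverNumber_le_of_transfer (image (Prod.map P P)) (hPo.prodMap hPo)
      (fun k U hU => ?_) fun W hWo hW => hP.hasSectionOver_image hWo hW.1 hW.2
    rw [← image_iUnion, hU, image_univ, (hP.surjective.prodMap hP.surjective).range_eq]
  · refine coverNumber_le_of_transfer (preimage (Prod.map P P))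
      (fun U hU => hU.preimage (hPc.prodMap hPc)) (fun k U hU => ?_) fun U _ hU =>
      ⟨fun g h x y hxy => ?_, hP.hasEquivariantPathSection hU⟩
    · rw [← preimage_iUnion, hU, preimage_univ]
    · simpa [DeckGroup.map_smul] using hxy

end UniversalCovering

theorem TC_le_stronglyEquivariantTC (G : Type*) [Group G] (Y : Type*) [TopologicalSpace Y]
    [MulAction G Y] : TC Y ≤ stronglyEquivariantTC G Y :=
  coverNumber_mono fun _ ⟨_, s, hs, _⟩ => ⟨s, hs⟩

end

theorem mainTheorem4 {X : Type u} [TopologicalSpace X] [T2Space X]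
    [CWComplex (Set.univ : Set X)] (hX : IsLocallyFiniteComplex X)
    {X' : Type v} [TopologicalSpace X'] {P : X' → X} (hP : IsUniversalCovering P) :
    TCTilde hP = stronglyEquivariantTC (DeckGroup P) X' ∧ TC X' ≤ TCTilde hP := by
  have := CWComplex.locallyPathConnectedSpace (X := X)
  have := hP.isCoveringMap.isLocalHomeomorph.locallyPathConnectedSpace
  have h := hP.TCTilde_eq_stronglyEquivariantTC
  exact ⟨h, h ▸ TC_le_stronglyEquivariantTC (DeckGroup P) X'⟩
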